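/- Let $G=(V,E_{\to},E_{\leftrightarrow})$ be a finite mixed graph: $E_{\to}$ is a set of ordered pairs $j\to k$ of distinct nodes, and $E_{\leftrightarrow}$ is a set of unordered pairs $j\leftrightarrow k$ of distinct nodes. Write $\mathrm{pa}(i)=\{j: j\to i\in E_{\to}\}$ and $\mathrm{sib}(i)=\{j: j\leftrightarrow i\in E_{\leftrightarrow}\}$, and let $G_{-i}$ be the subgraph of $G$ induced on $V\setminus\{i\}$. Let $\mathbf{B}(G)$ be the set of real $V\times V$ matrices $B=(\beta_{jk})$ with $I-B$ invertible and $\beta_{jk}=0$ whenever $k\to j\notin E_{\to}$, and let $\mathbf{\Omega}(G)$ be the set of positive definite symmetric real $V\times V$ matrices $\Omega=(\omega_{jk})$ with $\omega_{jk}=0$ whenever $j\ne k$ and $j\leftrightarrow k\notin E_{\leftrightarrow}$. Let $N\ge |V|$. For $i\in V$ and $(Y,B,\Omega)\in\mathbb{R}^{V\times N}\times\mathbf{B}(G)\times\mathbf{\Omega}(G)$, put $Z_{-i}=(\Omega_{-i,-i})^{-1}(I-B)_{-i}Y$, where $(I-B)_{-i}$ is $I-B$ without its $i$-th row and $\Omega_{-i,-i}$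 is $\Omega$ without its $i$-th row and column. Condition $(\mathrm{A1})_i$ says that the matrix $$\begin{pmatrix} Z_{\mathrm{sib}(i)}\\ Y_{\mathrm{pa}(i)\cup\{i\}}\end{pmatrix}\in\mathbb{R}^{(|\mathrm{sib}(i)|+|\mathrm{pa}(i)|+1)\times N}$$ has linearly independent rows. A property holds for generic triples $(Y,B,\Omega)$ if the triples in $\mathbb{R}^{V\times N}\times\mathbf{B}(G)\times\mathbf{\Omega}(G)$ that violate it lie in the zero set of a nonzero real polynomial in the free coordinates, that is, in the entries of $Y$, the $\beta_{kj}$ with $j\to k\in E_{\to}$, the $\omega_{jj}$ with $j\in V$, and the $\omega_{jk}$ with $j\leftrightarrow k\in E_{\leftrightarrow}$. A half-collider path is a path $i_1,\dots,i_k$ ($k\ge 1$, nodes not necessarily distinct) such that either all its edges are bi-directed (possibly there are none), or its first edge is $i_1\to i_2$ and all other edges (possibly none) are bi-directed. Its bi-directed portion is $\{i_1,\dots,i_k\}$ in the first case and $\{i_2,\dots,i_k\}$ in the second. A system of half-collider paths from $S_b$ to $S_e$ is a collection of $s=|S_b|=|S_e|$ half-collider paths, each from a node in $S_b$ to a node in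 $S_e$, such that every node in $S_b$ is the first node of some path and every node in $S_e$ is the last node of some path. Then, for every $i\in V$, the following are equivalent: (a) Condition $(\mathrm{A1})_i$ holds for generic triples $(Y,B,\Omega)\in\mathbb{R}^{V\times N}\times\mathbf{B}(G)\times\mathbf{\Omega}(G)$. (b) The graph $G_{-i}$ contains a system of half-collider paths from a subset of $V\setminus(\mathrm{pa}(i)\cup\{i\})$ to $\mathrm{sib}(i)$ whose bi-directed portions are pairwise disjoint. The equivalence also holds if "generic" in (a) is read in the measure-theoretic sense, that is, if the set of triples violating $(\mathrm{A1})_i$ has Lebesgue measure zero in the space of free coordinates. -/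

import Mathlib

open MeasureTheory

/-- A mixed graph on the vertex set `V`: directed edges (ordered pairs, no self-loops)
and bi-directed edges (unordered pairs of distinct nodes). -/
structure MixedGraph (V : Type*) where
  /-- `dir j k` means `j → k`. -/
  dir : V → V → Prop
  dir_irrefl : ∀ j, ¬ dir j j
  /-- `bi.Adj j k` means `j ↔ k`. -/
  bi : SimpleGraph V

namespace MixedGraph

/-- The parents of `i`: all `j` with `j → i`. -/
def pa {V : Type*} (G : MixedGraph V) (i : V) : Set V := {j | G.dir j i}

/-- The siblings of `i`: all `j` with `j ↔ i`. -/
def sib {V : Type*} (G : MixedGraph V) (i : V) : Set V := {j | G.bi.Adj j i}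

theorem ne_of_mem_sib {V : Type*} (G : MixedGraph V) {i j : V} (h : j ∈ G.sib i) : j ≠ i :=
  SimpleGraph.Adj.ne h

/-- The induced subgraph `G_{-i}` on `V ∖ {i}`. -/
def remove {V : Type*} (G : MixedGraph V) (i : V) : MixedGraph {j : V // j ≠ i} where
  dir j k := G.dir j k
  dir_irrefl j := G.dir_irrefl j
  bi := G.bi.comap Subtype.val

/-! ### Half-collider paths -/

/-- A half-collider path from `a` to `b`: either all of its edges are bi-directed (possibly there
is no edge at all), or its first edge is directed, pointing away from `a`, and all other edges
(possibly none) are bi-directed. Vertices may repeat. -/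
inductive HalfColliderPath {V : Type*} (G : MixedGraph V) : V → V → Type _
  | bidirected {a b : V} (p : G.bi.Walk a b) : HalfColliderPath G a b
  | directed {a m b : V} (h : G.dir a m) (p : G.bi.Walk m b) : HalfColliderPath G a b

/-- The bi-directed portion: all nodes of the path, except that the initial occurrence of the tail
of a directed first edge is not counted. -/
def HalfColliderPath.portion {V : Type*} {G : MixedGraph V} {a b : V} :
    G.HalfColliderPath a b → Set V
  | .bidirected p => {v | v ∈ p.support}
  | .directed _ p => {v | v ∈ p.support}

/-- A system of `s` half-collider paths from `Sb` to `Se`. -/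
structure HalfColliderSystem {V : Type*} (G : MixedGraph V) (Sb Se : Set V) (s : ℕ) where
  first : Fin s → V
  last : Fin s → V
  path : ∀ l, G.HalfColliderPath (first l) (last l)
  ncard_begin : Sb.ncard = s
  ncard_end : Se.ncard = s
  first_mem : ∀ l, first l ∈ Sb
  last_mem : ∀ l, last l ∈ Se
  exists_first : ∀ v ∈ Sb, ∃ l, first l = v
  exists_last : ∀ v ∈ Se, ∃ l, last l = v

/-- The bi-directed portions of the paths of the system are pairwise disjoint. -/
def HalfColliderSystem.DisjointPortions {V : Type*} {G : MixedGraph V} {Sb Se : Set V} {s : ℕ}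
    (P : G.HalfColliderSystem Sb Se s) : Prop :=
  ∀ l m : Fin s, l ≠ m → Disjoint (P.path l).portion (P.path m).portion

/-- `G_{-i}` contains a system of half-collider paths from a subset of `V ∖ (pa(i) ∪ {i})` to
`sib(i)` with pairwise disjoint bi-directed portions. The parents and siblings of `i` are those
in `G`; since the vertices of `G_{-i}` differ from `i`, the starting set avoids `i`. -/
def HalfColliderCriterion {V : Type*} (G : MixedGraph V) (i : V) : Prop :=
  ∃ (Sb : Set {j : V // j ≠ i}) (s : ℕ)
    (P : (G.remove i).HalfColliderSystem Sb {j | (j : V) ∈ G.sib i} s),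
    (∀ j ∈ Sb, (j : V) ∉ G.pa i) ∧ P.DisjointPortions

/-! ### Parameter matrices and the condition on the block update -/

/-- The set `𝐁(G)`; the entry `β_{jk}` belongs to the edge `k → j`. -/
def BSet {V : Type*} [Fintype V] [DecidableEq V] (G : MixedGraph V) : Set (Matrix V V ℝ) :=
  {B | IsUnit (1 - B) ∧ ∀ j k, ¬ G.dir k j → B j k = 0}

/-- The set `𝛀(G)` of positive definite symmetric matrices supported on the diagonal and on the
bi-directed edges. -/
def OmegaSet {V : Type*} [Fintype V] [DecidableEq V] (G : MixedGraph V) : Set (Matrix V V ℝ) :=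
  {Ω | Ω.PosDef ∧ ∀ j k, j ≠ k → ¬ G.bi.Adj j k → Ω j k = 0}

/-- The pseudo-variables `Z_{-i} = (Ω_{-i,-i})⁻¹ (I - B)_{-i} Y`. -/
noncomputable def pseudoVariables {V : Type*} [Fintype V] [DecidableEq V] {N : ℕ} (i : V)
    (Y : Matrix V (Fin N) ℝ) (B Ω : Matrix V V ℝ) : Matrix {j : V // j ≠ i} (Fin N) ℝ :=
  (Ω.submatrix (Subtype.val : {j : V // j ≠ i} → V) (Subtype.val : {j : V // j ≠ i} → V))⁻¹ *
    (((1 : Matrix V V ℝ) - B).submatrix (Subtype.val : {j : V // j ≠ i} → V) id * Y)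

/-- The matrix with the rows `Z_{sib(i)}` stacked on top of the rows `Y_{pa(i) ∪ {i}}`. -/
noncomputable def stackedMatrix {V : Type*} [Fintype V] [DecidableEq V] {N : ℕ} (G : MixedGraph V)
    (i : V) (Y : Matrix V (Fin N) ℝ) (B Ω : Matrix V V ℝ) :
    Matrix (G.sib i ⊕ ↥(G.pa i ∪ {i})) (Fin N) ℝ :=
  Matrix.of (Sum.elim (fun k => pseudoVariables i Y B Ω ⟨k, G.ne_of_mem_sib k.2⟩) (fun k => Y k))

/-- Condition `(A1)_i`: the stacked matrix has linearly independent rows. -/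
def CondA1 {V : Type*} [Fintype V] [DecidableEq V] {N : ℕ} (G : MixedGraph V)
    (i : V) (Y : Matrix V (Fin N) ℝ) (B Ω : Matrix V V ℝ) : Prop :=
  LinearIndependent ℝ (G.stackedMatrix i Y B Ω).row

/-! ### Genericity -/

/-- The free coordinates of a triple `(Y, B, Ω)`. -/
inductive Coord {V : Type*} (G : MixedGraph V) (N : ℕ) : Type _
  /-- the entry of `Y` in row `j` and column `n` -/
  | data (j : V) (n : Fin N) : Coord G N
  /-- the coefficient `β_{kj}` of the directed edge `j → k` -/
  | coeff (j k : V) (h : G.dir j k) : Coord G N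
  /-- the diagonal entry `ω_{jj}` -/
  | var (j : V) : Coord G N
  /-- the entry `ω_{jk} = ω_{kj}` of the bi-directed edge `{j, k}` -/
  | cov (e : G.bi.edgeSet) : Coord G N

instance {V : Type*} [Finite V] (G : MixedGraph V) (N : ℕ) : Finite (G.Coord N) := by
  let f : G.Coord N → (V × Fin N) ⊕ (V × V) ⊕ V ⊕ Sym2 V := fun c => match c with
    | .data j n => .inl (j, n)
    | .coeff j k _ => .inr (.inl (j, k))
    | .var j => .inr (.inr (.inl j))
    | .cov e => .inr (.inr (.inr e.1))
  have hf : Function.Injective f := by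
    intro c d h
    cases c <;> cases d <;> simp_all [f, Subtype.ext_iff]
  have : Finite (Sym2 V) := Quot.finite _
  exact Finite.of_injective f hf

noncomputable instance {V : Type*} [Finite V] (G : MixedGraph V) (N : ℕ) :
    Fintype (G.Coord N) := Fintype.ofFinite _

/-- The data matrix with coordinates `θ`. -/
def Coord.toY {V : Type*} {G : MixedGraph V} {N : ℕ} (θ : G.Coord N → ℝ) : Matrix V (Fin N) ℝ :=
  Matrix.of fun j n => θ (.data j n)

open Classical in
/-- The coefficient matrix with coordinates `θ`. -/
noncomputable def Coord.toB {V : Type*} {G : MixedGraph V} {N : ℕ} (θ : G.Coord N → ℝ) :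
    Matrix V V ℝ :=
  Matrix.of fun k j => if h : G.dir j k then θ (.coeff j k h) else 0

open Classical in
/-- The symmetric matrix with coordinates `θ`. -/
noncomputable def Coord.toOmega {V : Type*} {G : MixedGraph V} {N : ℕ} (θ : G.Coord N → ℝ) :
    Matrix V V ℝ :=
  Matrix.of fun j k =>
    if j = k then θ (.var j) else if h : s(j, k) ∈ G.bi.edgeSet then θ (.cov ⟨s(j, k), h⟩) else 0

/-- The coordinate vectors of those triples in `ℝ^{V × N} × 𝐁(G) × 𝛀(G)` that fail to have
the property `P`. -/
def exceptionalSet {V : Type*} [Fintype V] [DecidableEq V] (G : MixedGraph V) (N : ℕ)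
    (P : Matrix V (Fin N) ℝ → Matrix V V ℝ → Matrix V V ℝ → Prop) : Set (G.Coord N → ℝ) :=
  {θ | Coord.toB θ ∈ G.BSet ∧ Coord.toOmega θ ∈ G.OmegaSet ∧
    ¬ P (Coord.toY θ) (Coord.toB θ) (Coord.toOmega θ)}

/-- `P` holds for generic triples in the algebraic sense: the exceptional set is contained in the
zero set of a nonzero polynomial in the free coordinates. -/
def HoldsGenerically {V : Type*} [Fintype V] [DecidableEq V] (G : MixedGraph V) (N : ℕ)
    (P : Matrix V (Fin N) ℝ → Matrix V V ℝ → Matrix V V ℝ → Prop) : Prop :=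
  ∃ f : MvPolynomial (G.Coord N) ℝ, f ≠ 0 ∧
    ∀ θ ∈ G.exceptionalSet N P, MvPolynomial.eval θ f = 0

/-- `P` holds for generic triples in the measure-theoretic sense: the exceptional set has Lebesgue
measure zero in the space of free coordinates. -/
def HoldsAlmostEverywhere {V : Type*} [Fintype V] [DecidableEq V] (G : MixedGraph V) (N : ℕ)
    (P : Matrix V (Fin N) ℝ → Matrix V V ℝ → Matrix V V ℝ → Prop) : Prop :=
  volume (G.exceptionalSet N P) = 0

end MixedGraph

/-! ### Zero sets of polynomials are null. -/

theorem MvPolynomial.volume_setOf_eval_eq_zero_fin {n : ℕ} (f : MvPolynomial (Fin n) ℝ)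
    (hf : f ≠ 0) : volume {x : Fin n → ℝ | MvPolynomial.eval x f = 0} = 0 := by
  induction n with
  | zero =>
    have : {x : Fin 0 → ℝ | MvPolynomial.eval x f = 0} = ∅ := by
      refine Set.eq_empty_of_forall_notMem fun x hx => hf ?_
      refine MvPolynomial.funext fun y => ?_
      rw [Subsingleton.elim y x, map_zero]
      exact hx
    rw [this, measure_empty]
  | succ n ih =>
    set q := MvPolynomial.finSuccEquiv ℝ n f with hq
    have hq0 : q ≠ 0 := by simpa [hq] using hf
    -- The swap makes the Fubini slices lines in coordinate 0. Each has finitely many zeros unless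
    -- the leading coefficient in that variable vanishes, which by induction happens on a null set.
    have hmp := (volume_preserving_piFinSuccAbove (fun _ : Fin (n + 1) => ℝ) 0).symm.comp
      (Measure.measurePreserving_swap (μ := (volume : Measure (Fin n → ℝ)))
        (ν := (volume : Measure ℝ)))
    have hmeas : MeasurableSet {x : Fin (n + 1) → ℝ | MvPolynomial.eval x f = 0} :=
      (isClosed_singleton.preimage (MvPolynomial.continuous_eval f)).measurableSet
    rw [← hmp.measure_preimage hmeas.nullMeasurableSet,
      Measure.measure_prod_null (hmp.measurable hmeas)]
    have hlead := ih q.leadingCoeff (by simpa using hq0)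
    have hae : ∀ᵐ s : Fin n → ℝ, MvPolynomial.eval s q.leadingCoeff ≠ 0 := by
      simpa [ae_iff] using hlead
    filter_upwards [hae] with s hs
    have hmap : q.map (MvPolynomial.eval s) ≠ 0 := fun h => hs <| by
      have := congrArg (fun p => p.coeff q.natDegree) h
      simpa using this
    refine Set.Finite.measure_zero ?_ _
    refine Set.Finite.subset (Polynomial.finite_setOfPred_isRoot hmap) fun y hy => ?_
    have h1 : (MeasurableEquiv.piFinSuccAbove (fun _ : Fin (n + 1) => ℝ) 0).symm (y, s)
        = Fin.cons y s := by
      ext j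
      refine Fin.cases ?_ (fun j => ?_) j <;> simp [MeasurableEquiv.piFinSuccAbove]
    have h2 : MvPolynomial.eval
        ((MeasurableEquiv.piFinSuccAbove (fun _ : Fin (n + 1) => ℝ) 0).symm (y, s)) f = 0 := hy
    rw [h1, MvPolynomial.eval_eq_eval_mv_eval'] at h2
    exact h2

/-- The zero set of a nonzero real polynomial is a Lebesgue null set. -/
theorem MvPolynomial.volume_setOf_eval_eq_zero {σ : Type*} [Fintype σ] (f : MvPolynomial σ ℝ)
    (hf : f ≠ 0) : volume {x : σ → ℝ | MvPolynomial.eval x f = 0} = 0 := by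
  let e := Fintype.equivFin σ
  have hmp := volume_measurePreserving_piCongrLeft (fun _ : σ => ℝ) e.symm
  have hmeas : MeasurableSet {x : σ → ℝ | MvPolynomial.eval x f = 0} :=
    (isClosed_singleton.preimage (MvPolynomial.continuous_eval f)).measurableSet
  rw [← hmp.measure_preimage hmeas.nullMeasurableSet]
  have hr : MvPolynomial.rename e f ≠ 0 := fun h =>
    hf (MvPolynomial.rename_injective _ e.injective (by rw [h, map_zero]))
  convert MvPolynomial.volume_setOf_eval_eq_zero_fin _ hr using 2
  ext x
  simp only [Set.mem_preimage, Set.mem_ofPred_eq, MvPolynomial.eval_rename]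
  have : (MeasurableEquiv.piCongrLeft (fun _ : σ => ℝ) e.symm) x = x ∘ e := by
    ext j
    obtain ⟨k, rfl⟩ := e.symm.surjective j
    simp [MeasurableEquiv.coe_piCongrLeft, Equiv.piCongrLeft_apply_apply]
  rw [this]

/-! ### From nonzero minors to path systems. -/

theorem Equiv.Perm.exists_pos_iterate_inr {U ι : Type*} [Finite U] [Finite ι]
    (σ : Equiv.Perm (U ⊕ ι)) (s : ι) :
    ∃ n, 0 < n ∧ ∃ t : ι, (σ ^ n) (Sum.inr s) = Sum.inr t :=
  ⟨orderOf σ, orderOf_pos σ, s, by simp [pow_orderOf_eq_one]⟩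

namespace MixedGraph

/-- Following a permutation from `inr s` along entries supported on the diagonal and the
bi-directed edges traces out a walk. -/
theorem exists_walk_of_perm {U ι : Type*} (G : MixedGraph U) (e : ι → U)
    (σ : Equiv.Perm (U ⊕ ι))
    (h₁ : ∀ u v, σ (Sum.inl u) = Sum.inl v → u = v ∨ G.bi.Adj u v)
    (h₃ : ∀ s x, σ (Sum.inr s) = x → x = Sum.inl (e s))
    (s : ι) (k : ℕ) :
    (∀ j, 0 < j → j ≤ k + 1 → ∀ t, (σ ^ j) (Sum.inr s) ≠ Sum.inr t) →
    ∀ u, (σ ^ (k + 1)) (Sum.inr s) = Sum.inl u →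
      ∃ p : G.bi.Walk u (e s), ∀ v ∈ p.support,
        ∃ j, 0 < j ∧ j ≤ k + 1 ∧ (σ ^ j) (Sum.inr s) = Sum.inl v := by
  induction k with
  | zero =>
    intro _ u hu
    have h := h₃ s _ hu
    obtain rfl := Sum.inl_injective h
    exact ⟨.nil, fun v hv => ⟨1, one_pos, le_rfl, by simp_all⟩⟩
  | succ k ih =>
    intro hk u hu
    obtain ⟨w, hw⟩ : ∃ w, (σ ^ (k + 1)) (Sum.inr s) = Sum.inl w := by
      rcases h : (σ ^ (k + 1)) (Sum.inr s) with w | t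
      · exact ⟨w, rfl⟩
      · exact absurd h (hk _ k.succ_pos (Nat.le_succ _) t)
    obtain ⟨p, hp⟩ := ih (fun j hj hj' => hk j hj (hj'.trans (Nat.le_succ _))) w hw
    have hp' : ∀ v ∈ p.support,
        ∃ j, 0 < j ∧ j ≤ k + 1 + 1 ∧ (σ ^ j) (Sum.inr s) = Sum.inl v := fun v hv => by
      obtain ⟨j, hj, hj', h⟩ := hp v hv
      exact ⟨j, hj, hj'.trans (Nat.le_succ _), h⟩
    have hwu : σ (Sum.inl w) = Sum.inl u := by
      rw [← hu, pow_succ' σ (k + 1), Equiv.Perm.mul_apply, hw]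
    rcases h₁ w u hwu with rfl | hadj
    · exact ⟨p, hp'⟩
    · refine ⟨.cons hadj.symm p, fun v hv => ?_⟩
      rw [SimpleGraph.Walk.support_cons, List.mem_cons] at hv
      rcases hv with rfl | hv
      · exact ⟨_, Nat.succ_pos _, le_rfl, hu⟩
      · exact hp' v hv

/-- A transversal of the matrix `[Ω, I - B; E, 0]` yields a system of half-collider paths with
disjoint bi-directed portions. -/
theorem exists_system_of_perm {U ι : Type*} [Finite U] [Fintype ι] (G : MixedGraph U)
    (e f : ι → U) (he : Function.Injective e) (hf : Function.Injective f)
    (σ : Equiv.Perm (U ⊕ ι))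
    (h₁ : ∀ u v, σ (Sum.inl u) = Sum.inl v → u = v ∨ G.bi.Adj u v)
    (h₂ : ∀ u t, σ (Sum.inl u) = Sum.inr t → f t = u ∨ G.dir (f t) u)
    (h₃ : ∀ s x, σ (Sum.inr s) = x → x = Sum.inl (e s)) :
    ∃ P : G.HalfColliderSystem (Set.range f) (Set.range e) (Fintype.card ι),
      P.DisjointPortions := by
  classical
  have hex := fun s => σ.exists_pos_iterate_inr s
  -- First return time of the orbit of `s` to the `ι` side; `τ s` below is the point of return.
  let n : ι → ℕ := fun s => Nat.find (hex s)
  have hn : ∀ s, 0 < n s ∧ ∃ t : ι, (σ ^ n s) (Sum.inr s) = Sum.inr t :=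
    fun s => Nat.find_spec (hex s)
  have hmin : ∀ s j, 0 < j → j < n s → ∀ t, (σ ^ j) (Sum.inr s) ≠ Sum.inr t :=
    fun s j hj hjn t h => Nat.find_min (hex s) hjn ⟨hj, t, h⟩
  choose hpos τ hτ using hn
  -- orbits of different starting points do not meet before they return
  have hmeet : ∀ s s' j j', 0 < j → j ≤ j' → j' ≤ n s' →
      (σ ^ j) (Sum.inr s) = (σ ^ j') (Sum.inr s') → s = s' := by
    intro s s' j j' hj hjj' hj' h
    obtain ⟨d, rfl⟩ := Nat.exists_eq_add_of_le hjj'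
    rw [pow_add, Equiv.Perm.mul_apply] at h
    have h := (σ ^ j).injective h
    rcases Nat.eq_zero_or_pos d with rfl | hd
    · simpa using h
    · exact absurd h.symm (hmin s' d hd (by omega) s)
  have hmeet' : ∀ s s' j j', 0 < j → 0 < j' → j ≤ n s → j' ≤ n s' →
      (σ ^ j) (Sum.inr s) = (σ ^ j') (Sum.inr s') → s = s' := by
    intro s s' j j' hj hj' hjn hjn' h
    rcases le_total j j' with hle | hle
    · exact hmeet s s' j j' hj hle hjn' h
    · exact (hmeet s' s j' j hj' hle hjn h.symm).symm
  have hτinj : Function.Injective τ := fun s s' h =>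
    hmeet' s s' _ _ (hpos s) (hpos s') le_rfl le_rfl (by rw [hτ, hτ, h])
  have hτsurj : Function.Surjective τ := Finite.surjective_of_injective hτinj
  have hpath : ∀ s, ∃ p : G.HalfColliderPath (f (τ s)) (e s), ∀ v ∈ p.portion,
      ∃ j, 0 < j ∧ j ≤ n s ∧ (σ ^ j) (Sum.inr s) = Sum.inl v := by
    intro s
    obtain ⟨m, hm⟩ : ∃ m, n s = m + 1 := ⟨n s - 1, by have := hpos s; omega⟩
    have hm0 : m ≠ 0 := by
      rintro rfl
      have h := hτ s
      rw [hm] at h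
      exact absurd (h₃ s _ h) (by simp)
    obtain ⟨k, rfl⟩ := Nat.exists_eq_succ_of_ne_zero hm0
    obtain ⟨u, hu⟩ : ∃ u, (σ ^ (k + 1)) (Sum.inr s) = Sum.inl u := by
      rcases h : (σ ^ (k + 1)) (Sum.inr s) with w | t
      · exact ⟨w, rfl⟩
      · exact absurd h (hmin s _ k.succ_pos (by omega) t)
    obtain ⟨p, hp⟩ := G.exists_walk_of_perm e σ h₁ h₃ s k
      (fun j hj hj' => hmin s j hj (by omega)) u hu
    have hut : σ (Sum.inl u) = Sum.inr (τ s) := by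
      rw [← hτ, hm, Nat.succ_eq_add_one, pow_succ' σ (k + 1), Equiv.Perm.mul_apply, hu]
    have hp' : ∀ v ∈ p.support,
        ∃ j, 0 < j ∧ j ≤ n s ∧ (σ ^ j) (Sum.inr s) = Sum.inl v := fun v hv => by
      obtain ⟨j, hj, hj', h⟩ := hp v hv
      exact ⟨j, hj, by omega, h⟩
    -- The orbit leaves `U` through an entry of `I - B`: a diagonal one adds no edge, an
    -- off-diagonal one is the directed first edge.
    rcases h₂ u (τ s) hut with h | h
    · subst h
      exact ⟨.bidirected p, hp'⟩
    · exact ⟨.directed h p, hp'⟩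
  choose p hp using hpath
  let q : Fin (Fintype.card ι) ≃ ι := (Fintype.equivFin ι).symm
  refine ⟨{ first := fun l => f (τ (q l))
            last := fun l => e (q l)
            path := fun l => p (q l)
            ncard_begin := by
              rw [← Set.image_univ, Set.ncard_image_of_injective _ hf, Set.ncard_univ,
                Nat.card_eq_fintype_card]
            ncard_end := by
              rw [← Set.image_univ, Set.ncard_image_of_injective _ he, Set.ncard_univ,
                Nat.card_eq_fintype_card]
            first_mem := fun l => ⟨_, rfl⟩
            last_mem := fun l => ⟨_, rfl⟩
            exists_first := ?_
            exists_last := ?_ }, ?_⟩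
  · rintro _ ⟨t, rfl⟩
    obtain ⟨s, rfl⟩ := hτsurj t
    exact ⟨q.symm s, by simp⟩
  · rintro _ ⟨s, rfl⟩
    exact ⟨q.symm s, by simp⟩
  · intro l m hlm
    refine Set.disjoint_left.2 fun v hv hv' => hlm (q.injective ?_)
    obtain ⟨j, hj, hjn, h⟩ := hp _ v hv
    obtain ⟨j', hj', hjn', h'⟩ := hp _ v hv'
    exact hmeet' _ _ _ _ hj hj' hjn hjn' (h.trans h'.symm)

/-- If a square submatrix of `Ω⁻¹ (I - B)` is nonsingular, then there is a system of half-collider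
paths from its columns to its rows with disjoint bi-directed portions. -/
theorem exists_system_of_det_ne_zero {U ι : Type*} [Fintype U] [DecidableEq U] [Fintype ι]
    [DecidableEq ι] (G : MixedGraph U) (e f : ι → U) (he : Function.Injective e)
    (hf : Function.Injective f) (B Ω : Matrix U U ℝ) (hB : ∀ j k, ¬ G.dir k j → B j k = 0)
    (hΩ : ∀ j k, j ≠ k → ¬ G.bi.Adj j k → Ω j k = 0) (hdet : Ω.det ≠ 0)
    (h : ((Ω⁻¹ * (1 - B)).submatrix e f).det ≠ 0) :
    ∃ P : G.HalfColliderSystem (Set.range f) (Set.range e) (Fintype.card ι),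
      P.DisjointPortions := by
  -- The Schur complement of `Ω` in this matrix is minus the given minor.
  let M : Matrix (U ⊕ ι) (U ⊕ ι) ℝ := Matrix.fromBlocks Ω ((1 - B).submatrix id f)
    ((1 : Matrix U U ℝ).submatrix e id) 0
  have hM : M.det ≠ 0 := by
    let _ := Matrix.invertibleOfIsUnitDet Ω hdet.isUnit
    rw [Matrix.det_fromBlocks₁₁]
    have : (1 : Matrix U U ℝ).submatrix e id * ⅟Ω * (1 - B).submatrix id f
        = (Ω⁻¹ * (1 - B)).submatrix e f := by
      rw [Matrix.invOf_eq_nonsing_inv]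
      ext a b
      simp [Matrix.mul_apply, Matrix.one_apply]
    rw [this, zero_sub, Matrix.det_neg]
    exact mul_ne_zero hdet (mul_ne_zero (by simp) h)
  obtain ⟨σ, hσ⟩ : ∃ σ : Equiv.Perm (U ⊕ ι), ∀ x, M x (σ x) ≠ 0 := by
    rw [← Matrix.det_transpose, Matrix.det_apply] at hM
    obtain ⟨σ, -, hσ⟩ := Finset.exists_ne_zero_of_sum_ne_zero hM
    refine ⟨σ, fun x hx => hσ ?_⟩
    rw [Finset.prod_eq_zero (Finset.mem_univ x) (by simpa using hx), smul_zero]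
  refine G.exists_system_of_perm e f he hf σ ?_ ?_ ?_
  · intro u v huv
    have := hσ (Sum.inl u)
    rw [huv] at this
    by_contra! hcon
    exact this (hΩ u v hcon.1 hcon.2)
  · intro u t hut
    have := hσ (Sum.inl u)
    rw [hut] at this
    by_contra! hcon
    exact this (by simp [M, hcon.1.symm, hB u (f t) hcon.2])
  · rintro s (u | t) hst
    · have := hσ (Sum.inr s)
      rw [hst] at this
      by_contra hcon
      refine this ?_
      have : e s ≠ u := fun h => hcon (by rw [h])
      simp [M, this]
    · have := hσ (Sum.inr s)
      rw [hst] at this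
      exact absurd rfl this

end MixedGraph

/-! ### Positivity and block structure of the inverse of identity plus Laplacian. -/

namespace SimpleGraph

variable {U : Type*} [Fintype U] [DecidableEq U]

theorem one_add_lapMatrix_posDef (H : SimpleGraph U) [DecidableRel H.Adj] :
    (1 + H.lapMatrix ℝ).PosDef :=
  Matrix.PosDef.one.add_posSemidef (H.posSemidef_lapMatrix ℝ)

theorem one_add_lapMatrix_mul_inv (H : SimpleGraph U) [DecidableRel H.Adj] :
    (1 + H.lapMatrix ℝ) * (1 + H.lapMatrix ℝ)⁻¹ = 1 :=
  Matrix.mul_nonsing_inv _ H.one_add_lapMatrix_posDef.det_pos.ne'.isUnit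

theorem inv_one_add_lapMatrix_equation (H : SimpleGraph U) [DecidableRel H.Adj] (u v : U) :
    (1 + H.lapMatrix ℝ)⁻¹ u v =
      ∑ w ∈ H.neighborFinset u, ((1 + H.lapMatrix ℝ)⁻¹ w v - (1 + H.lapMatrix ℝ)⁻¹ u v) +
        (1 : Matrix U U ℝ) u v := by
  have h := congrFun (congrFun H.one_add_lapMatrix_mul_inv u) v
  have h' : ((1 + H.lapMatrix ℝ) * (1 + H.lapMatrix ℝ)⁻¹) u v =
      ((1 + H.lapMatrix ℝ).mulVec (fun w => (1 + H.lapMatrix ℝ)⁻¹ w v)) u := rfl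
  rw [h', Matrix.add_mulVec, Matrix.one_mulVec, Pi.add_apply, lapMatrix_mulVec_apply] at h
  rw [← h, Finset.sum_sub_distrib, Finset.sum_const, card_neighborFinset_eq_degree, nsmul_eq_mul]
  ring

/-- Minimum principle: at a row minimizing the column, every neighbour difference in the equation is
nonnegative. -/
theorem inv_one_add_lapMatrix_nonneg (H : SimpleGraph U) [DecidableRel H.Adj] (u v : U) :
    0 ≤ (1 + H.lapMatrix ℝ)⁻¹ u v := by
  have : Nonempty U := ⟨u⟩
  obtain ⟨m, hm⟩ := Finite.exists_min fun w => (1 + H.lapMatrix ℝ)⁻¹ w v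
  refine le_trans ?_ (hm u)
  rw [inv_one_add_lapMatrix_equation]
  refine add_nonneg (Finset.sum_nonneg fun w _ => sub_nonneg.2 (hm w)) ?_
  rw [Matrix.one_apply]
  split_ifs <;> norm_num

/-- Strong form of the minimum principle: a zero entry would equal a sum of nonnegative terms, one
of which is positive by induction along the walk (or is the diagonal 1). -/
theorem inv_one_add_lapMatrix_pos (H : SimpleGraph U) [DecidableRel H.Adj] {u v : U}
    (p : H.Walk u v) : 0 < (1 + H.lapMatrix ℝ)⁻¹ u v := by
  induction p with
  | nil =>
    rename_i u
    refine (H.inv_one_add_lapMatrix_nonneg u u).lt_of_ne' fun h => ?_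
    have heq := H.inv_one_add_lapMatrix_equation u u
    simp only [h, sub_zero, Matrix.one_apply_eq] at heq
    have := Finset.sum_nonneg fun w (_ : w ∈ H.neighborFinset u) =>
      H.inv_one_add_lapMatrix_nonneg w u
    linarith
  | cons hadj p ih =>
    rename_i u w v
    refine (H.inv_one_add_lapMatrix_nonneg u v).lt_of_ne' fun h => ?_
    have heq := H.inv_one_add_lapMatrix_equation u v
    simp only [h, sub_zero] at heq
    have h1 : 0 ≤ (1 : Matrix U U ℝ) u v := by
      rw [Matrix.one_apply]
      split_ifs <;> norm_num
    have h2 := Finset.single_le_sum (fun w (_ : w ∈ H.neighborFinset u) =>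
      H.inv_one_add_lapMatrix_nonneg w v) ((H.mem_neighborFinset u w).2 hadj)
    linarith

/-- `S` is a union of components, so its diagonal indicator matrix commutes with `1 + L`, hence with
the inverse. -/
theorem inv_one_add_lapMatrix_eq_zero (H : SimpleGraph U) [DecidableRel H.Adj] (S : Set U)
    (hS : ∀ u v, H.Adj u v → u ∈ S → v ∈ S) {u v : U} (hu : u ∈ S) (hv : v ∉ S) :
    (1 + H.lapMatrix ℝ)⁻¹ u v = 0 := by
  classical
  set A := 1 + H.lapMatrix ℝ with hA
  let D : Matrix U U ℝ := Matrix.diagonal (S.indicator 1)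
  have hcomm : A * D = D * A := by
    ext a b
    rw [Matrix.mul_diagonal, Matrix.diagonal_mul, mul_comm]
    by_cases hab : a = b
    · rw [hab]
    by_cases hadj : H.Adj a b
    · have : a ∈ S ↔ b ∈ S := ⟨hS a b hadj, hS b a hadj.symm⟩
      by_cases ha : a ∈ S
      · simp [ha, this.1 ha]
      · simp [ha, mt this.2 ha]
    · have : A a b = 0 := by
        simp [hA, lapMatrix, degMatrix, hab, hadj, adjMatrix_apply]
      rw [this, mul_zero, mul_zero]
  have hunit : IsUnit A.det := H.one_add_lapMatrix_posDef.det_pos.ne'.isUnit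
  have hcomm' : A⁻¹ * D = D * A⁻¹ := by
    calc A⁻¹ * D = A⁻¹ * (D * A) * A⁻¹ := by
          rw [Matrix.mul_assoc, Matrix.mul_assoc, Matrix.mul_nonsing_inv _ hunit, Matrix.mul_one]
      _ = D * A⁻¹ := by
          rw [← hcomm, ← Matrix.mul_assoc, Matrix.nonsing_inv_mul _ hunit, Matrix.one_mul]
  have h := congrFun (congrFun hcomm' u) v
  rw [Matrix.mul_diagonal, Matrix.diagonal_mul] at h
  simpa [hu, hv] using h.symm

end SimpleGraph

/-! ### From path systems to nonzero minors. -/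

namespace MixedGraph

theorem HalfColliderPath.exists_walk {U : Type*} {G : MixedGraph U} {a b : U}
    (p : G.HalfColliderPath a b) :
    ∃ (t : U) (q : G.bi.Walk t b), p.portion = {v | v ∈ q.support} ∧ (t ≠ a → G.dir a t) := by
  cases p with
  | bidirected q => exact ⟨_, q, rfl, fun h => absurd rfl h⟩
  | directed h q => exact ⟨_, q, rfl, fun _ => h⟩

theorem HalfColliderSystem.first_injective {U : Type*} [Finite U] {G : MixedGraph U}
    {Sb Se : Set U} {s : ℕ} (P : G.HalfColliderSystem Sb Se s) :
    Function.Injective P.first := by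
  let g : Fin s → Sb := fun l => ⟨P.first l, P.first_mem l⟩
  have hg : Function.Surjective g := fun ⟨v, hv⟩ => by
    obtain ⟨l, hl⟩ := P.exists_first v hv
    exact ⟨l, Subtype.ext hl⟩
  have hb : Function.Bijective g := by
    refine hg.bijective_of_nat_card_le ?_
    rw [Nat.card_coe_set_eq, P.ncard_begin, Nat.card_eq_fintype_card, Fintype.card_fin]
  exact fun l m h => hb.1 (Subtype.ext h)

theorem HalfColliderSystem.last_injective {U : Type*} [Finite U] {G : MixedGraph U}
    {Sb Se : Set U} {s : ℕ} (P : G.HalfColliderSystem Sb Se s) :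
    Function.Injective P.last := by
  let g : Fin s → Se := fun l => ⟨P.last l, P.last_mem l⟩
  have hg : Function.Surjective g := fun ⟨v, hv⟩ => by
    obtain ⟨l, hl⟩ := P.exists_last v hv
    exact ⟨l, Subtype.ext hl⟩
  have hb : Function.Bijective g := by
    refine hg.bijective_of_nat_card_le ?_
    rw [Nat.card_coe_set_eq, P.ncard_end, Nat.card_eq_fintype_card, Fintype.card_fin]
  exact fun l m h => hb.1 (Subtype.ext h)

/-- The parameters adapted to a system of half-collider paths with disjoint bi-directed portions
make the corresponding submatrix of `Ω⁻¹ (I - B)` nonsingular. -/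
theorem HalfColliderSystem.exists_det_ne_zero {U : Type*} [Fintype U] [DecidableEq U]
    {G : MixedGraph U} {Sb Se : Set U} {s : ℕ} (P : G.HalfColliderSystem Sb Se s)
    (hP : P.DisjointPortions) :
    ∃ B Ω : Matrix U U ℝ, (∀ j k, ¬ G.dir k j → B j k = 0) ∧ Ω.IsSymm ∧
      (∀ j k, j ≠ k → ¬ G.bi.Adj j k → Ω j k = 0) ∧ Ω.det ≠ 0 ∧
      ((Ω⁻¹ * (1 - B)).submatrix P.last P.first).det ≠ 0 := by
  classical
  choose t q hq ht using fun l => (P.path l).exists_walk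
  have hdisj : ∀ l m v, v ∈ (q l).support → v ∈ (q m).support → l = m := by
    intro l m v hl hm
    by_contra hne
    have := hP l m hne
    rw [hq, hq] at this
    exact Set.disjoint_left.1 this hl hm
  -- Keeping only bi-directed edges inside a single portion makes each portion connected and closed
  -- under adjacency, so `K` is positive within a portion and zero between portions.
  let H : SimpleGraph U :=
    { Adj := fun u v => G.bi.Adj u v ∧ ∃ l, u ∈ (q l).support ∧ v ∈ (q l).support
      symm := ⟨fun u v h => ⟨h.1.symm, h.2.imp fun _ h => h.symm⟩⟩
      loopless := ⟨fun u h => G.bi.irrefl h.1⟩ }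
  let K := (1 + H.lapMatrix ℝ)⁻¹
  have hKpos : ∀ l, 0 < K (P.last l) (t l) := by
    intro l
    refine H.inv_one_add_lapMatrix_pos ((q l).transfer H fun e he => ?_).reverse
    induction e with
    | h u v =>
      exact ⟨(q l).adj_of_mem_edges he, l, (q l).fst_mem_support_of_mem_edges he,
        (q l).snd_mem_support_of_mem_edges he⟩
  have hKzero : ∀ l m, l ≠ m → K (P.last l) (t m) = 0 := by
    intro l m hlm
    refine H.inv_one_add_lapMatrix_eq_zero {v | v ∈ (q l).support} ?_ (q l).end_mem_support
      fun h => hlm (hdisj l m _ h (q m).start_mem_support)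
    rintro u v ⟨-, k, hu, hv⟩ hu'
    rwa [hdisj l k u hu' hu]
  -- In column `l` the coefficient `c` will affect only the diagonal entry of the minor, so a large
  -- `c` forces dominance. The extra summand absorbs the constant part of that entry.
  obtain ⟨c, hc⟩ : ∃ c : ℝ, ∀ l, ∑ m ∈ Finset.univ.erase l, ‖K (P.last m) (P.first l)‖ +
      K (P.last l) (P.first l) < c * K (P.last l) (t l) := by
    have : ∀ᶠ c : ℝ in Filter.atTop, ∀ l,
        ∑ m ∈ Finset.univ.erase l, ‖K (P.last m) (P.first l)‖ +
          K (P.last l) (P.first l) < c * K (P.last l) (t l) := by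
      rw [Filter.eventually_all]
      exact fun l => (Filter.tendsto_id.atTop_mul_const (hKpos l)).eventually_gt_atTop _
    exact this.exists
  let B : Matrix U U ℝ := Matrix.of fun k j =>
    if ∃ l, k = t l ∧ j = P.first l ∧ t l ≠ P.first l then c else 0
  have htinj : ∀ l m, t l = t m → l = m := fun l m h =>
    hdisj l m (t l) (q l).start_mem_support (by rw [h]; exact (q m).start_mem_support)
  have hentry : ∀ m n, (K * (1 - B)) (P.last m) (P.first n) = K (P.last m) (P.first n) -
      K (P.last m) (t n) * (if t n ≠ P.first n then c else 0) := by
    intro m n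
    rw [Matrix.mul_sub, Matrix.mul_one, Matrix.sub_apply, Matrix.mul_apply,
      Finset.sum_eq_single (t n)]
    · congr 2
      refine if_congr ⟨?_, fun h => ⟨n, rfl, rfl, h⟩⟩ rfl rfl
      rintro ⟨l, h1, -, h⟩
      obtain rfl := htinj _ _ h1
      exact h
    · intro k _ hk
      have : B k (P.first n) = 0 := by
        refine if_neg ?_
        rintro ⟨l, h1, h2, -⟩
        exact hk (P.first_injective h2 ▸ h1)
      rw [this, mul_zero]
    · simp
  refine ⟨B, 1 + H.lapMatrix ℝ, ?_, Matrix.isSymm_one.add (H.isSymm_lapMatrix (R := ℝ)), ?_,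
    H.one_add_lapMatrix_posDef.det_pos.ne', ?_⟩
  · intro j k hjk
    refine if_neg ?_
    rintro ⟨l, rfl, rfl, h⟩
    exact hjk (ht l h)
  · intro j k hjk hadj
    have : ¬ H.Adj j k := fun h => hadj h.1
    simp [SimpleGraph.lapMatrix, SimpleGraph.degMatrix, hjk, this, SimpleGraph.adjMatrix_apply]
  · refine det_ne_zero_of_sum_col_lt_diag fun n => ?_
    change ∑ m ∈ Finset.univ.erase n, ‖(K * (1 - B)) (P.last m) (P.first n)‖ <
      ‖(K * (1 - B)) (P.last n) (P.first n)‖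
    have hoff : ∀ m ∈ Finset.univ.erase n, ‖(K * (1 - B)) (P.last m) (P.first n)‖ =
        ‖K (P.last m) (P.first n)‖ := by
      intro m hm
      rw [hentry, hKzero m n (Finset.ne_of_mem_erase hm), zero_mul, sub_zero]
    rw [Finset.sum_congr rfl hoff, hentry]
    -- Without a directed first edge there is no `c` in this column, but its off-diagonal entries
    -- vanish because `t n = P.first n`.
    by_cases hn : t n = P.first n
    · rw [if_neg (not_not.2 hn), mul_zero, sub_zero, ← hn]
      rw [Finset.sum_eq_zero fun m hm => by
        rw [hKzero m n (Finset.ne_of_mem_erase hm), norm_zero]]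
      exact norm_pos_iff.2 (hKpos n).ne'
    · rw [if_pos hn, ← norm_neg]
      have := hc n
      refine lt_of_lt_of_le ?_ (le_abs_self _)
      linarith

end MixedGraph

/-! ### Linear algebra: minors, Gram determinants, stacked rows, positive definiteness near the
identity. -/

namespace Matrix

/-- Select a basis of the column space among the columns; it has `card ι` members since row rank
equals column rank. -/
theorem exists_det_submatrix_ne_zero {ι W : Type*} [Fintype ι] [DecidableEq ι] [Fintype W]
    (A : Matrix ι W ℝ) (hA : LinearIndependent ℝ A.row) :
    ∃ f : ι → W, Function.Injective f ∧ (A.submatrix id f).det ≠ 0 := by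
  classical
  obtain ⟨κ, a, ha, hspan, hli⟩ := exists_linearIndependent' ℝ A.col
  have : Fintype κ := Fintype.ofInjective a ha
  have hcard : Fintype.card ι = Fintype.card κ := by
    rw [← hA.rank_matrix, rank_eq_finrank_span_cols, ← hspan, finrank_span_eq_card hli]
  let e : ι ≃ κ := Fintype.equivOfCardEq hcard
  refine ⟨a ∘ e, ha.comp e.injective, ?_⟩
  have hcols : LinearIndependent ℝ (A.submatrix id (a ∘ e)).col := hli.comp e e.injective
  rw [linearIndependent_cols_iff_isUnit, isUnit_iff_isUnit_det] at hcols
  exact hcols.ne_zero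

theorem det_mul_transpose_self_ne_zero_iff {m n : Type*} [Fintype m] [DecidableEq m] [Fintype n]
    (S : Matrix m n ℝ) : (S * Sᵀ).det ≠ 0 ↔ LinearIndependent ℝ S.row := by
  have key : LinearIndependent ℝ S.row ↔ Fintype.card m = S.rank := by
    rw [linearIndependent_iff_card_eq_finrank_span, rank_eq_finrank_span_row]
    rfl
  have key' : LinearIndependent ℝ (S * Sᵀ).row ↔ Fintype.card m = (S * Sᵀ).rank := by
    rw [linearIndependent_iff_card_eq_finrank_span, rank_eq_finrank_span_row]
    rfl
  rw [key, ← rank_self_mul_transpose, ← key', linearIndependent_rows_iff_isUnit,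
    isUnit_iff_isUnit_det, isUnit_iff_ne_zero]

open Classical in
theorem sum_smul_sumElim_row {ι V n : Type*} [Fintype ι] [Fintype V] (R : Matrix ι V ℝ)
    (Q : Set V) (Y : Matrix V n ℝ) (g : ι ⊕ Q → ℝ) :
    ∑ k, g k • (Sum.elim (fun k => (R * Y) k) (fun k : Q => Y k) : ι ⊕ Q → n → ℝ) k =
      ((g ∘ Sum.inl) ᵥ* R + fun v => if h : v ∈ Q then g (Sum.inr ⟨v, h⟩) else 0) ᵥ* Y := by
  rw [add_vecMul, vecMul_vecMul, Fintype.sum_sum_type]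
  congr 1
  · ext x
    simp [vecMul, dotProduct, Finset.sum_apply]
  · ext x
    simp only [Sum.elim_inr, Finset.sum_apply, Pi.smul_apply, smul_eq_mul, vecMul, dotProduct]
    rw [← Fintype.sum_subtype_add_sum_subtype (· ∈ Q), Finset.sum_eq_zero (s := Finset.univ)
      (f := fun v : {v // v ∉ Q} => _) fun v _ => by rw [dif_neg v.2, zero_mul], add_zero]
    exact Finset.sum_congr rfl fun v _ => by rw [dif_pos v.2]

theorem linearIndependent_submatrix_compl_of_sumElim {ι V n : Type*} [Fintype ι] [Fintype V]
    (R : Matrix ι V ℝ) (Q : Set V) (Y : Matrix V n ℝ)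
    (h : LinearIndependent ℝ
      (Sum.elim (fun k => (R * Y) k) (fun k : Q => Y k) : ι ⊕ Q → n → ℝ)) :
    LinearIndependent ℝ (R.submatrix id (Subtype.val : ↥Qᶜ → V)).row := by
  classical
  rw [Fintype.linearIndependent_iff] at h ⊢
  intro c hc k
  -- A relation that holds off `Q` extends to the whole stack: the rows of `Y` in `Q` cancel what
  -- remains.
  refine h (Sum.elim c fun v => -(c ᵥ* R) v) ?_ (Sum.inl k)
  rw [sum_smul_sumElim_row]
  convert zero_vecMul Y
  ext v
  by_cases hv : v ∈ Q
  · simp [hv]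
  · have := congrFun hc ⟨v, hv⟩
    simp only [Finset.sum_apply, Pi.smul_apply, smul_eq_mul, Pi.zero_apply, row_apply,
      submatrix_apply, id] at this
    simpa [hv, vecMul, dotProduct] using this

theorem linearIndependent_sumElim_of_submatrix_compl {ι V n : Type*} [Fintype ι] [Fintype V]
    (R : Matrix ι V ℝ) (Q : Set V) (Y : Matrix V n ℝ) (hY : ∀ x, x ᵥ* Y = 0 → x = 0)
    (h : LinearIndependent ℝ (R.submatrix id (Subtype.val : ↥Qᶜ → V)).row) :
    LinearIndependent ℝ
      (Sum.elim (fun k => (R * Y) k) (fun k : Q => Y k) : ι ⊕ Q → n → ℝ) := by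
  classical
  rw [Fintype.linearIndependent_iff] at h ⊢
  intro g hg
  rw [sum_smul_sumElim_row] at hg
  have hg := hY _ hg
  have hc := h (g ∘ Sum.inl) <| by
    ext ⟨v, hv⟩
    have := congrFun hg v
    simp only [Pi.add_apply, dif_neg hv, add_zero, vecMul, dotProduct, Pi.zero_apply] at this
    simpa [Finset.sum_apply] using this
  rintro (k | k)
  · exact hc k
  · have h0 : g ∘ Sum.inl = 0 := funext hc
    have := congrFun hg k
    simpa [h0] using this

theorem posDef_of_abs_sub_one_lt {V : Type*} [Fintype V] [DecidableEq V] (Ω : Matrix V V ℝ)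
    (hsymm : Ω.IsSymm)
    (h : ∀ j k, |Ω j k - (1 : Matrix V V ℝ) j k| < 1 / (Fintype.card V + 1)) : Ω.PosDef := by
  set n : ℝ := (Fintype.card V : ℝ) with hn
  set ε : ℝ := 1 / (n + 1) with hε
  have hn0 : 0 ≤ n := Nat.cast_nonneg _
  have hε0 : 0 < ε := by positivity
  refine Matrix.PosDef.of_dotProduct_mulVec_pos (by simpa [IsHermitian, IsSymm] using hsymm)
    fun x hx => ?_
  have hpos : 0 < ∑ j, x j ^ 2 := by
    obtain ⟨j, hj⟩ := Function.ne_iff.1 hx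
    exact Finset.sum_pos' (fun _ _ => sq_nonneg _) ⟨j, Finset.mem_univ _, by
      have : x j ≠ 0 := hj
      positivity⟩
  have hone : ∑ j, x j ^ 2 = ∑ j, ∑ k, x j * (1 : Matrix V V ℝ) j k * x k := by
    simp [Matrix.one_apply, sq]
  have hquad : star x ⬝ᵥ Ω *ᵥ x = ∑ j, ∑ k, x j * Ω j k * x k := by
    simp [dotProduct, mulVec, Finset.mul_sum, mul_assoc]
  -- Entrywise `|x j * x k| ≤ (x j ^ 2 + x k ^ 2) / 2`; summed up, the form loses at most `ε * n <
  -- 1` times the squared norm.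
  have hdiff : star x ⬝ᵥ Ω *ᵥ x - ∑ j, x j ^ 2 ≥ ∑ j, ∑ k, -(ε / 2) * (x j ^ 2 + x k ^ 2) := by
    rw [hquad, hone, ← Finset.sum_sub_distrib]
    refine Finset.sum_le_sum fun j _ => ?_
    rw [← Finset.sum_sub_distrib]
    refine Finset.sum_le_sum fun k _ => ?_
    obtain ⟨h1, h2⟩ := abs_lt.1 (h j k)
    set E := Ω j k - (1 : Matrix V V ℝ) j k with hE
    have : x j * Ω j k * x k - x j * (1 : Matrix V V ℝ) j k * x k = E * (x j * x k) := by
      rw [hE]; ring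
    rw [this]
    nlinarith [mul_nonneg (sub_nonneg.2 h1.le) (sq_nonneg (x j + x k)),
      mul_nonneg (sub_nonneg.2 h2.le) (sq_nonneg (x j - x k))]
  have hsum : ∑ j, ∑ k, -(ε / 2) * (x j ^ 2 + x k ^ 2) = -(ε * n) * ∑ j, x j ^ 2 := by
    simp_rw [← Finset.mul_sum, Finset.sum_add_distrib, Finset.sum_const, Finset.card_univ,
      nsmul_eq_mul, ← Finset.mul_sum, ← hn]
    ring
  have hεn : ε * n < 1 := by
    rw [hε, one_div, inv_mul_lt_iff₀ (by positivity)]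
    linarith
  rw [hsum] at hdiff
  nlinarith

end Matrix

namespace MixedGraph

variable {V : Type*} (G : MixedGraph V) {N : ℕ}

/-! ### The parameter space has positive measure -/

theorem toB_apply_of_not_dir (θ : G.Coord N → ℝ) (j k : V) (h : ¬ G.dir k j) :
    Coord.toB θ j k = 0 := by
  simp [Coord.toB, h]

theorem toOmega_apply_of_not_adj (θ : G.Coord N → ℝ) (j k : V) (hjk : j ≠ k)
    (h : ¬ G.bi.Adj j k) : Coord.toOmega θ j k = 0 := by
  simp [Coord.toOmega, h, hjk]

theorem toOmega_isSymm (θ : G.Coord N → ℝ) : (Coord.toOmega θ).IsSymm := by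
  ext j k
  by_cases hjk : j = k
  · rw [hjk]; rfl
  · by_cases h : s(j, k) ∈ G.bi.edgeSet
    · have h' : s(k, j) ∈ G.bi.edgeSet := Sym2.eq_swap (a := j) ▸ h
      simp only [Matrix.transpose_apply, Coord.toOmega, Matrix.of_apply, if_neg hjk,
        if_neg (Ne.symm hjk), dif_pos h, dif_pos h', Sym2.eq_swap (a := k)]
    · have h' : s(k, j) ∉ G.bi.edgeSet := Sym2.eq_swap (a := j) ▸ h
      simp only [Matrix.transpose_apply, Coord.toOmega, Matrix.of_apply, if_neg hjk,
        if_neg (Ne.symm hjk), dif_neg h, dif_neg h']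

/-- The principal submatrix obtained by deleting row and column `i`. -/
abbrev deleteNode {V R : Type*} (i : V) (A : Matrix V V R) :
    Matrix {j : V // j ≠ i} {j : V // j ≠ i} R :=
  A.submatrix Subtype.val Subtype.val

/-- Entries involving `i` are filled with zeros, so the resulting `Ω` is not positive definite. This
is harmless: the point only has to witness that a polynomial is nonzero. -/
theorem exists_coord_of_deleteNode [DecidableEq V] (i : V) (Y : Matrix V (Fin N) ℝ)
    (B Ω : Matrix {j : V // j ≠ i} {j : V // j ≠ i} ℝ)
    (hB : ∀ j k, ¬ (G.remove i).dir k j → B j k = 0) (hsymm : Ω.IsSymm)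
    (hΩ : ∀ j k, j ≠ k → ¬ (G.remove i).bi.Adj j k → Ω j k = 0) :
    ∃ θ : G.Coord N → ℝ, Coord.toY θ = Y ∧ deleteNode i (Coord.toB θ) = B ∧
      deleteNode i (Coord.toOmega θ) = Ω := by
  let extend (A : Matrix {j : V // j ≠ i} {j : V // j ≠ i} ℝ) (j k : V) : ℝ :=
    if h : j ≠ i ∧ k ≠ i then A ⟨j, h.1⟩ ⟨k, h.2⟩ else 0
  have hext : ∀ A (j k : {j : V // j ≠ i}), extend A j k = A j k := fun A j k =>
    dif_pos ⟨j.2, k.2⟩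
  have hswap : ∀ j k, extend Ω j k = extend Ω k j := by
    intro j k
    by_cases h : j ≠ i ∧ k ≠ i
    · rw [hext Ω ⟨j, h.1⟩ ⟨k, h.2⟩, hext Ω ⟨k, h.2⟩ ⟨j, h.1⟩, hsymm.apply]
    · simp only [extend, dif_neg h, dif_neg (mt And.symm h)]
  let θ : G.Coord N → ℝ := fun c => match c with
    | .data j n => Y j n
    | .coeff j k _ => extend B k j
    | .var j => extend Ω j j
    | .cov e => Sym2.lift ⟨extend Ω, hswap⟩ e.1
  refine ⟨θ, rfl, ?_, ?_⟩
  · ext k j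
    by_cases h : G.dir j k
    · simpa [Coord.toB, h, θ] using hext B k j
    · simpa [Coord.toB, h] using (hB k j h).symm
  · ext j k
    by_cases hjk : j = k
    · simpa [Coord.toOmega, hjk, θ] using hext Ω k k
    · have hjk' : (j : V) ≠ k := fun h => hjk (Subtype.ext h)
      by_cases h : G.bi.Adj j k
      · simpa [Coord.toOmega, hjk', h, θ] using hext Ω j k
      · simpa [Coord.toOmega, hjk', h] using (hΩ j k hjk h).symm

variable [Fintype V] [DecidableEq V] (i : V)

theorem exists_params_not_mem_of_volume_eq_zero (s : Set (G.Coord N → ℝ)) (hs : volume s = 0) :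
    ∃ θ : G.Coord N → ℝ, Coord.toB θ ∈ G.BSet ∧ Coord.toOmega θ ∈ G.OmegaSet ∧ θ ∉ s := by
  have hBcont : Continuous fun θ : G.Coord N → ℝ => Coord.toB θ := by
    refine continuous_matrix fun j k => ?_
    simp only [Coord.toB, Matrix.of_apply]
    split_ifs <;> fun_prop
  have hΩcont : ∀ j k, Continuous fun θ : G.Coord N → ℝ => Coord.toOmega θ j k := by
    intro j k
    simp only [Coord.toOmega, Matrix.of_apply]
    split_ifs <;> fun_prop
  -- An open set around `B = 0`, `Ω = 1` inside the parameter set, with the radius required by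
  -- `posDef_of_abs_sub_one_lt`.
  let O : Set (G.Coord N → ℝ) := {θ | (1 - Coord.toB θ).det ≠ 0} ∩
    ⋂ j, ⋂ k, {θ | |Coord.toOmega θ j k - (1 : Matrix V V ℝ) j k| < 1 / (Fintype.card V + 1)}
  have hO : IsOpen O := by
    refine IsOpen.inter ?_ (isOpen_iInter_of_finite fun j => isOpen_iInter_of_finite fun k => ?_)
    · exact isOpen_ne_fun (continuous_const.sub hBcont).matrix_det continuous_const
    · exact isOpen_lt ((hΩcont j k).sub continuous_const).abs continuous_const
  let θ₁ : G.Coord N → ℝ := fun c => match c with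
    | .data _ _ => 0
    | .coeff _ _ _ => 0
    | .var _ => 1
    | .cov _ => 0
  have hB₁ : Coord.toB θ₁ = 0 := by
    ext j k
    simp [Coord.toB, θ₁]
  have hΩ₁ : Coord.toOmega θ₁ = 1 := by
    ext j k
    by_cases hjk : j = k <;> simp [Coord.toOmega, θ₁, hjk, Matrix.one_apply]
  have hne : O.Nonempty := by
    refine ⟨θ₁, by simp [hB₁], ?_⟩
    simp only [Set.mem_iInter]
    intro j k
    simp only [Set.mem_ofPred_eq, hΩ₁, sub_self, abs_zero]
    positivity
  obtain ⟨θ, hθO, hθs⟩ : ∃ θ ∈ O, θ ∉ s := by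
    by_contra! hcon
    exact (hO.measure_pos volume hne).ne' (measure_mono_null hcon hs)
  obtain ⟨hθB, hθΩ⟩ := hθO
  simp only [Set.mem_iInter] at hθΩ
  refine ⟨θ, ⟨?_, G.toB_apply_of_not_dir θ⟩, ⟨?_, G.toOmega_apply_of_not_adj θ⟩, hθs⟩
  · rw [Matrix.isUnit_iff_isUnit_det]
    exact IsUnit.mk0 _ hθB
  · exact Matrix.posDef_of_abs_sub_one_lt _ (G.toOmega_isSymm θ) hθΩ

/-! ### The condition `(A1)_i` in terms of minors of `Ω⁻¹ (I - B)` -/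

/-- The rows of `(Ω_{-i,-i})⁻¹ (I - B)_{-i}` that belong to the siblings of `i`. -/
noncomputable def siblingRows (B Ω : Matrix V V ℝ) : Matrix (G.sib i) V ℝ :=
  ((deleteNode i Ω)⁻¹ *
    ((1 : Matrix V V ℝ) - B).submatrix (Subtype.val : {j : V // j ≠ i} → V) id).submatrix
    (fun k => ⟨k, G.ne_of_mem_sib k.2⟩) id

theorem stackedMatrix_row_eq (Y : Matrix V (Fin N) ℝ) (B Ω : Matrix V V ℝ) :
    (G.stackedMatrix i Y B Ω).row =
      Sum.elim (fun k => (G.siblingRows i B Ω * Y) k) (fun k : ↥(G.pa i ∪ {i}) => Y k) := by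
  funext k
  rcases k with k | k
  · simp only [stackedMatrix, pseudoVariables, ← Matrix.mul_assoc]
    rfl
  · rfl

/-- Away from column `i`, the sibling rows involve only the parameters of G_{-i}. -/
theorem siblingRows_apply (B Ω : Matrix V V ℝ) (k : G.sib i) (v : {j : V // j ≠ i}) :
    G.siblingRows i B Ω k v =
      ((deleteNode i Ω)⁻¹ * (1 - deleteNode i B)) ⟨k, G.ne_of_mem_sib k.2⟩ v := by
  have : (1 : Matrix {j : V // j ≠ i} {j : V // j ≠ i} ℝ) = deleteNode i (1 : Matrix V V ℝ) := by
    rw [deleteNode, Matrix.submatrix_one _ Subtype.val_injective]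
  rw [this]
  simp only [siblingRows, Matrix.submatrix_apply, Matrix.mul_apply, Matrix.sub_apply, id]

theorem halfColliderCriterion_of_condA1 (Y : Matrix V (Fin N) ℝ) (B Ω : Matrix V V ℝ)
    (hB : B ∈ G.BSet) (hΩ : Ω ∈ G.OmegaSet) (h : G.CondA1 i Y B Ω) :
    G.HalfColliderCriterion i := by
  classical
  rw [CondA1, stackedMatrix_row_eq] at h
  obtain ⟨f, hf, hdet⟩ := Matrix.exists_det_submatrix_ne_zero _
    (Matrix.linearIndependent_submatrix_compl_of_sumElim _ _ _ h)
  have hfi : ∀ k, (f k : V) ≠ i := fun k hk => (f k).2 (Or.inr hk)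
  have hfpa : ∀ k, (f k : V) ∉ G.pa i := fun k hk => (f k).2 (Or.inl hk)
  let e : G.sib i → {j : V // j ≠ i} := fun k => ⟨k, G.ne_of_mem_sib k.2⟩
  let f' : G.sib i → {j : V // j ≠ i} := fun k => ⟨f k, hfi k⟩
  have hsys := (G.remove i).exists_system_of_det_ne_zero e f'
    (fun k l hkl => Subtype.ext (congrArg (fun u : {j : V // j ≠ i} => (u : V)) hkl))
    (fun k l hkl => hf (Subtype.ext (congrArg (fun u : {j : V // j ≠ i} => (u : V)) hkl)))
    (deleteNode i B) (deleteNode i Ω)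
    (fun j k hjk => hB.2 j k hjk)
    (fun j k hjk hadj => hΩ.2 j k (fun h => hjk (Subtype.ext h)) hadj)
    (hΩ.1.submatrix Subtype.val_injective).det_pos.ne' (by
      convert hdet using 2
      ext k l
      exact (G.siblingRows_apply i B Ω k (f' l)).symm)
  have hrange : Set.range e = ({j | (j : V) ∈ G.sib i} : Set {j : V // j ≠ i}) := by
    ext j
    exact ⟨by rintro ⟨k, rfl⟩; exact k.2, fun hj => ⟨⟨j, hj⟩, rfl⟩⟩
  rw [hrange] at hsys
  obtain ⟨P, hP⟩ := hsys
  exact ⟨_, _, P, by rintro _ ⟨k, rfl⟩; exact hfpa k, hP⟩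

/-! ### The polynomial certificate -/

theorem condA1_of_det_ne_zero (Y : Matrix V (Fin N) ℝ) (hY : ∀ x, Matrix.vecMul x Y = 0 → x = 0)
    (B Ω : Matrix V V ℝ) {s : ℕ} {Sb : Set {j : V // j ≠ i}}
    (P : (G.remove i).HalfColliderSystem Sb {j | (j : V) ∈ G.sib i} s)
    (hSb : ∀ j ∈ Sb, (j : V) ∉ G.pa i)
    (h : (((deleteNode i Ω)⁻¹ * (1 - deleteNode i B)).submatrix P.last P.first).det ≠ 0) :
    G.CondA1 i Y B Ω := by
  classical
  rw [CondA1, stackedMatrix_row_eq]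
  refine Matrix.linearIndependent_sumElim_of_submatrix_compl _ _ _ hY ?_
  let g : Fin s → G.sib i := fun l => ⟨P.last l, P.last_mem l⟩
  have hg : Function.Bijective g := by
    refine ⟨fun l m hlm => P.last_injective (Subtype.ext
      (congrArg (fun u : G.sib i => (u : V)) hlm)), fun k => ?_⟩
    obtain ⟨l, hl⟩ := P.exists_last ⟨k, G.ne_of_mem_sib k.2⟩ k.2
    exact ⟨l, Subtype.ext (congrArg (fun u : {j : V // j ≠ i} => (u : V)) hl)⟩
  rw [← linearIndependent_equiv (Equiv.ofBijective g hg)]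
  let c : Fin s → ↥(G.pa i ∪ {i})ᶜ := fun l => ⟨P.first l, by
    rintro (h | h)
    · exact hSb _ (P.first_mem l) h
    · exact (P.first l).2 h⟩
  -- Independence may be tested on the columns `P.first l`, which lie outside pa(i) ∪ {i}.
  refine LinearIndependent.of_comp (LinearMap.funLeft ℝ ℝ c) ?_
  have hrows : LinearIndependent ℝ (((deleteNode i Ω)⁻¹ * (1 - deleteNode i B)).submatrix
      P.last P.first).row := Matrix.linearIndependent_rows_of_det_ne_zero h
  have heq : (((deleteNode i Ω)⁻¹ * (1 - deleteNode i B)).submatrix P.last P.first).row =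
      LinearMap.funLeft ℝ ℝ c ∘ ((G.siblingRows i B Ω).submatrix id Subtype.val).row ∘
        Equiv.ofBijective g hg := by
    ext l m
    exact (G.siblingRows_apply i B Ω (g l) (P.first m)).symm
  rwa [heq] at hrows

/-- The generic data matrix. -/
noncomputable def polyY (N : ℕ) : Matrix V (Fin N) (MvPolynomial (G.Coord N) ℝ) :=
  Matrix.of fun j n => MvPolynomial.X (.data j n)

open Classical in
/-- The generic coefficient matrix. -/
noncomputable def polyB (N : ℕ) : Matrix V V (MvPolynomial (G.Coord N) ℝ) :=
  Matrix.of fun k j => if h : G.dir j k then MvPolynomial.X (.coeff j k h) else 0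

open Classical in
/-- The generic covariance matrix. -/
noncomputable def polyOmega (N : ℕ) : Matrix V V (MvPolynomial (G.Coord N) ℝ) :=
  Matrix.of fun j k => if j = k then MvPolynomial.X (.var j) else
    if h : s(j, k) ∈ G.bi.edgeSet then MvPolynomial.X (.cov ⟨s(j, k), h⟩) else 0

/-- The stacked matrix with the inverse replaced by the adjugate. -/
def adjStacked {R : Type*} [CommRing R] (Y : Matrix V (Fin N) R) (B Ω : Matrix V V R) :
    Matrix (G.sib i ⊕ ↥(G.pa i ∪ {i})) (Fin N) R :=
  Matrix.of (Sum.elim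
    (fun k => ((deleteNode i Ω).adjugate *
      (((1 : Matrix V V R) - B).submatrix (Subtype.val : {j : V // j ≠ i} → V) id * Y))
        ⟨k, G.ne_of_mem_sib k.2⟩)
    (fun k => Y k))

theorem adjStacked_map {R S : Type*} [CommRing R] [CommRing S] (φ : R →+* S)
    (Y : Matrix V (Fin N) R) (B Ω : Matrix V V R) :
    (G.adjStacked i Y B Ω).map φ = G.adjStacked i (Y.map φ) (B.map φ) (Ω.map φ) := by
  have h1 : (deleteNode i (Ω.map φ)).adjugate = (deleteNode i Ω).adjugate.map φ := by
    have := φ.map_adjugate (deleteNode i Ω)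
    simpa [RingHom.mapMatrix_apply, deleteNode, Matrix.submatrix_map] using this.symm
  have h2 : (1 - B.map φ : Matrix V V S) = (1 - B).map φ := by
    ext j k
    by_cases hjk : j = k <;> simp [hjk]
  ext (k | k) n
  · simp only [adjStacked, Matrix.map_apply, Matrix.of_apply, Sum.elim_inl, h1, h2,
      Matrix.mul_apply, Matrix.submatrix_apply, map_sum, map_mul]
  · rfl

/-- The adjugate keeps the entries polynomial and only rescales the sibling rows by a nonzero
determinant. -/
theorem adjStacked_row_linearIndependent_iff (Y : Matrix V (Fin N) ℝ) (B Ω : Matrix V V ℝ)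
    (hdet : (deleteNode i Ω).det ≠ 0) :
    LinearIndependent ℝ (G.adjStacked i Y B Ω).row ↔ G.CondA1 i Y B Ω := by
  let w : G.sib i ⊕ ↥(G.pa i ∪ {i}) → ℝˣ := Sum.elim (fun _ => Units.mk0 _ hdet) 1
  rw [CondA1, ← LinearIndependent.units_smul_iff (G.stackedMatrix i Y B Ω).row w]
  have hadj : (deleteNode i Ω).adjugate = (deleteNode i Ω).det • (deleteNode i Ω)⁻¹ := by
    rw [Matrix.inv_def, smul_smul, Ring.mul_inverse_cancel _ hdet.isUnit, one_smul]
  convert Iff.rfl using 2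
  funext k
  rcases k with k | k
  · ext n
    simp [adjStacked, hadj, w, stackedMatrix, pseudoVariables, Units.smul_def, Matrix.mul_apply,
      Finset.mul_sum]
  · ext n
    simp [adjStacked, w, stackedMatrix]

/-- The Gram determinant of the adjugate version of the stacked matrix. -/
noncomputable def certificate (N : ℕ) [Fintype (G.sib i ⊕ ↥(G.pa i ∪ {i}))]
    [DecidableEq (G.sib i ⊕ ↥(G.pa i ∪ {i}))] : MvPolynomial (G.Coord N) ℝ :=
  (G.adjStacked i (G.polyY N) (G.polyB N) (G.polyOmega N) *
    (G.adjStacked i (G.polyY N) (G.polyB N) (G.polyOmega N)).transpose).det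

/-- Asking only that `Ω_{-i,-i}` be invertible lets this apply both on the parameter set and at the
witness outside it. -/
theorem eval_certificate_ne_zero_iff [Fintype (G.sib i ⊕ ↥(G.pa i ∪ {i}))]
    [DecidableEq (G.sib i ⊕ ↥(G.pa i ∪ {i}))] (θ : G.Coord N → ℝ)
    (hdet : (deleteNode i (Coord.toOmega θ)).det ≠ 0) :
    MvPolynomial.eval θ (G.certificate i N) ≠ 0 ↔
      G.CondA1 i (Coord.toY θ) (Coord.toB θ) (Coord.toOmega θ) := by
  have hY : (G.polyY N).map (MvPolynomial.eval θ) = Coord.toY θ := by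
    ext j n
    simp [polyY, Coord.toY]
  have hB : (G.polyB N).map (MvPolynomial.eval θ) = Coord.toB θ := by
    ext j k
    by_cases h : G.dir k j <;> simp [polyB, Coord.toB, h]
  have hΩ : (G.polyOmega N).map (MvPolynomial.eval θ) = Coord.toOmega θ := by
    ext j k
    by_cases hjk : j = k
    · simp [polyOmega, Coord.toOmega, hjk]
    · by_cases h : G.bi.Adj j k <;> simp [polyOmega, Coord.toOmega, hjk, h]
  rw [← G.adjStacked_row_linearIndependent_iff i _ _ _ hdet, certificate, RingHom.map_det,
    RingHom.mapMatrix_apply, Matrix.map_mul, Matrix.transpose_map, adjStacked_map, hY, hB, hΩ]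
  exact Matrix.det_mul_transpose_self_ne_zero_iff _

theorem holdsGenerically_of_halfColliderCriterion (hN : Fintype.card V ≤ N)
    (h : G.HalfColliderCriterion i) : G.HoldsGenerically N (G.CondA1 i) := by
  classical
  obtain ⟨Sb, s, P, hSb, hP⟩ := h
  obtain ⟨B, Ω, hB, hsymm, hΩ, hdet, hminor⟩ := P.exists_det_ne_zero hP
  obtain ⟨a⟩ : Nonempty (V ↪ Fin N) := Function.Embedding.nonempty_of_card_le (by simpa using hN)
  -- The rows are distinct unit vectors, available because `card V ≤ N`.
  let Y : Matrix V (Fin N) ℝ := (1 : Matrix (Fin N) (Fin N) ℝ).submatrix a id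
  have hY : ∀ x, Matrix.vecMul x Y = 0 → x = 0 := by
    intro x hx
    ext v
    have := congrFun hx (a v)
    simpa [Y, Matrix.vecMul, dotProduct, Matrix.one_apply] using this
  obtain ⟨θ₀, hθY, hθB, hθΩ⟩ := G.exists_coord_of_deleteNode i Y B Ω hB hsymm hΩ
  refine ⟨G.certificate i N, fun h0 => ?_, fun θ hθ => ?_⟩
  · have hne := (G.eval_certificate_ne_zero_iff i θ₀ (by rwa [hθΩ])).2
      (G.condA1_of_det_ne_zero i _ (by rwa [hθY]) _ _ P hSb (by rwa [hθB, hθΩ]))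
    exact hne (by rw [h0, map_zero])
  · obtain ⟨-, hθΩ', hA1⟩ := hθ
    by_contra hne
    exact hA1 ((G.eval_certificate_ne_zero_iff i θ
      (hθΩ'.1.submatrix Subtype.val_injective).det_pos.ne').1 hne)

end MixedGraph

theorem mainTheorem4 {V : Type*} [Fintype V] [DecidableEq V] (G : MixedGraph V) (i : V)
    (N : ℕ) (hN : Fintype.card V ≤ N) :
    (G.HoldsGenerically N (G.CondA1 i) ↔ G.HalfColliderCriterion i) ∧
      (G.HoldsAlmostEverywhere N (G.CondA1 i) ↔ G.HalfColliderCriterion i) := by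
  have hba := G.holdsGenerically_of_halfColliderCriterion (N := N) i hN
  have hae : G.HoldsGenerically N (G.CondA1 i) → G.HoldsAlmostEverywhere N (G.CondA1 i) := by
    rintro ⟨f, hf, hzero⟩
    exact measure_mono_null hzero (f.volume_setOf_eval_eq_zero hf)
  have hab : G.HoldsAlmostEverywhere N (G.CondA1 i) → G.HalfColliderCriterion i := by
    intro h
    obtain ⟨θ, hB, hΩ, hθ⟩ := G.exists_params_not_mem_of_volume_eq_zero _ h
    refine G.halfColliderCriterion_of_condA1 i (MixedGraph.Coord.toY θ) _ _ hB hΩ ?_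
    by_contra hA1
    exact hθ ⟨hB, hΩ, hA1⟩
  exact ⟨⟨hab ∘ hae, hba⟩, ⟨hab, hae ∘ hba⟩⟩
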